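/- Let $\mathcal{A}$ be a semi-abelian category (pointed, Barr exact, protomodular, with binary coproducts). For objects $A, B, C$ let $A\otimes B$ be the kernel $\iota_{A,B}$ of the canonical morphism $A+B\to A\times B$, and $A\otimes B\otimes C$ the kernel of the canonical morphism $A+B+C\to (A+B)\times(A+C)\times(B+C)$, whose three components send $C$, $B$, $A$, respectively, to $0$ and are the coproduct inclusions on the other two summands. For subobjects $K,L,M$ of $X$, let $K\vee L$ be the image of $K+L\to X$, let $[K,L]$ be the image of $K\otimes L\to K+L\to X$, and let $[K,L,M]$ be the image of $K\otimes L\otimes M\to K+L+M\to X$. The normalisation of an equivalence relation $(R,r_1,r_2)$ on $X$ is the subobject $r_2\circ\ker(r_1)\colon \mathrm{Ker}(r_1)\to X$; the denormalisation of a normal subobject $N$ of $X$ (one represented by a kernel) is the kernel pair of the cokernel of $N\to X$. Two reflexive relations $(R,r_1,r_2)$ and $(S,s_1,s_2)$ on $X$, with diagonals $\Delta_R$, $\Delta_S$, Smith-commute if there is $\theta\colon R\times_X S\to X$ on the pullback of $r_1$ and $s_2$ with $\theta\langle 1_R,\Delta_S r_1\rangle=r_2$ and $\theta\langle\Delta_R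 s_2,1_S\rangle=s_1$. The Smith commutator $[R,S]^{\mathrm S}$ of equivalence relations $R,S$ on $X$ is the smallest equivalence relation $T$ on $X$ such that the direct images of $R$ and $S$ along the quotient $X\to X/T$ Smith-commute. For a normal subobject $n\colon N\to X$, the conjugation action of $X$ on $N$ is the unique $\gamma\colon N\otimes X\to N$ with $n\circ\gamma=c_2^X\circ(n\otimes 1_X)$, where $c_2^X\colon X\otimes X\to X+X\to X$ is the inclusion followed by the codiagonal. The semi-direct product $N\rtimes_\gamma X$ is the coequaliser $q\colon N+X\to N\rtimes_\gamma X$ of $\iota_{N,X}$ and $\iota_N\circ\gamma\colon N\otimes X\to N+X$ (where $q\circ\iota_N$ is a monomorphism). It carries the two morphisms to $X$ induced by $\left\langle\begin{smallmatrix}0\\1_X\end{smallmatrix}\right\rangle$ and $\left\langle\begin{smallmatrix}n\\1_X\end{smallmatrix}\right\rangle\colon N+X\to X$, and the morphism $s_\gamma=q\circ\iota_X\colon X\to N\rtimes_\gamma X$. **Theorem.** Let $R$ and $S$ be equivalence relations on an object $X$ of a semi-abelian category, with normalisations $K$ and $L$, and let $N=[K,L,X]\vee[K,L]$. Then $N$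 is a normal subobject of $X$, and the Smith commutator $[R,S]^{\mathrm S}$ exists and is the equivalence relation $$N\rtimes_\gamma X\ \rightrightarrows\ X,\qquad \left\langle\begin{smallmatrix}0\\1_X\end{smallmatrix}\right\rangle,\ \left\langle\begin{smallmatrix}n\\1_X\end{smallmatrix}\right\rangle,$$ with diagonal $s_\gamma\colon X\to N\rtimes_\gamma X$, where $\gamma$ is the conjugation action of $X$ on $N$. It is the denormalisation of $N$. If $K\vee L=X$, then $[K,L]$ is normal in $X$ and the same holds with $[K,L]$ in place of $N$: $[R,S]^{\mathrm S}$ is the equivalence relation $[K,L]\rtimes_\gamma X\rightrightarrows X$, which is the denormalisation of $[K,L]$. -/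

import Mathlib

open CategoryTheory CategoryTheory.Limits

universe v u

noncomputable section

/-- A semi-abelian category: pointed, finitely complete and regular, protomodular (in the pointed
form of the Split Short Five Lemma), Barr exact, and with binary coproducts. -/
class SemiAbelian (C : Type u) [Category.{v} C] [HasZeroMorphisms C] : Prop
    extends Regular C, HasZeroObject C where
  hasBinaryCoproducts : HasBinaryCoproducts C
  /-- The Split Short Five Lemma. -/
  split_short_five {A' X' G' A X G : C}
    {k' : A' ⟶ X'} {p' : X' ⟶ G'} {s' : G' ⟶ X'} (wk' : k' ≫ p' = 0)
    (_ : IsLimit (KernelFork.ofι k' wk')) (_ : s' ≫ p' = 𝟙 G')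
    {k : A ⟶ X} {p : X ⟶ G} {s : G ⟶ X} (wk : k ≫ p = 0)
    (_ : IsLimit (KernelFork.ofι k wk)) (_ : s ≫ p = 𝟙 G)
    (a : A' ⟶ A) (x : X' ⟶ X) (g : G' ⟶ G)
    (_ : k' ≫ x = a ≫ k) (_ : p' ≫ g = x ≫ p) (_ : s' ≫ x = g ≫ s)
    (_ : IsIso a) (_ : IsIso g) : IsIso x
  /-- Every internal equivalence relation is the kernel pair of some morphism. -/
  effective {R X : C} (r₁ r₂ : R ⟶ X) (_ : IsEquivalenceRelation r₁ r₂) :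
    ∃ (Y : C) (f : X ⟶ Y), IsKernelPair f r₁ r₂

attribute [instance] SemiAbelian.hasBinaryCoproducts

namespace SemiAb

variable {C : Type u} [Category.{v} C] [HasZeroMorphisms C] [SemiAbelian C]

/-! ### Co-smash products and commutators of subobjects -/

/-- The comparison morphism `X + Y ⟶ X × Y`. -/
def comparison₂ (X Y : C) : X ⨿ Y ⟶ X ⨯ Y :=
  coprod.desc (prod.lift (𝟙 X) 0) (prod.lift 0 (𝟙 Y))

/-- The binary co-smash product `X ⊗ Y`, the kernel of `X + Y ⟶ X × Y`. -/
def cosmash₂ (X Y : C) : C := kernel (comparison₂ X Y)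

/-- The kernel inclusion `X ⊗ Y ⟶ X + Y`. -/
def cosmashι₂ (X Y : C) : cosmash₂ X Y ⟶ X ⨿ Y := kernel.ι (comparison₂ X Y)

/-- The comparison morphism `X + Y + Z ⟶ (X + Y) × (X + Z) × (Y + Z)`; its three components omit
`Z`, `Y` and `X`, respectively. -/
def comparison₃ (X Y Z : C) : (X ⨿ Y) ⨿ Z ⟶ ((X ⨿ Y) ⨯ (X ⨿ Z)) ⨯ (Y ⨿ Z) :=
  prod.lift
    (prod.lift
      (coprod.desc (coprod.desc coprod.inl coprod.inr) 0)
      (coprod.desc (coprod.desc coprod.inl 0) coprod.inr))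
    (coprod.desc (coprod.desc 0 coprod.inl) coprod.inr)

/-- The ternary co-smash product `X ⊗ Y ⊗ Z`. -/
def cosmash₃ (X Y Z : C) : C := kernel (comparison₃ X Y Z)

/-- The kernel inclusion `X ⊗ Y ⊗ Z ⟶ X + Y + Z`. -/
def cosmashι₃ (X Y Z : C) : cosmash₃ X Y Z ⟶ (X ⨿ Y) ⨿ Z := kernel.ι (comparison₃ X Y Z)

lemma comparison₂_naturality {X Y X' Y' : C} (f : X ⟶ X') (g : Y ⟶ Y') :
    comparison₂ X Y ≫ prod.map f g = coprod.map f g ≫ comparison₂ X' Y' := by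
  unfold comparison₂
  ext <;> simp

/-- The morphism `f ⊗ g : X ⊗ Y ⟶ X' ⊗ Y'`. -/
def cosmashMap₂ {X Y X' Y' : C} (f : X ⟶ X') (g : Y ⟶ Y') : cosmash₂ X Y ⟶ cosmash₂ X' Y' :=
  kernel.map _ _ (coprod.map f g) (prod.map f g) (comparison₂_naturality f g)

/-- The binary commutator morphism `X ⊗ X ⟶ X + X ⟶ X`. -/
def commutatorMorphism₂ (X : C) : cosmash₂ X X ⟶ X := cosmashι₂ X X ≫ coprod.desc (𝟙 X) (𝟙 X)

/-- The (Higgins) commutator `[K, L]` of subobjects `K`, `L` of `X`: the image of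
`K ⊗ L ⟶ K + L ⟶ X`. -/
def commutator₂ {X : C} (K L : Subobject X) : Subobject X :=
  imageSubobject (cosmashι₂ (K : C) (L : C) ≫ coprod.desc K.arrow L.arrow)

/-- The ternary commutator `[K, L, M]` of subobjects `K`, `L`, `M` of `X`: the image of
`K ⊗ L ⊗ M ⟶ K + L + M ⟶ X`. -/
def commutator₃ {X : C} (K L M : Subobject X) : Subobject X :=
  imageSubobject (cosmashι₃ (K : C) (L : C) (M : C) ≫
    coprod.desc (coprod.desc K.arrow L.arrow) M.arrow)

/-! ### Normal subobjects, normalisation and denormalisation -/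

/-- A subobject is normal when it is represented by a kernel. -/
def IsNormalSubobject {X : C} (N : Subobject X) : Prop := Nonempty (NormalMono N.arrow)

instance mono_kernel_comp {R X : C} {r₁ r₂ : R ⟶ X} [JointlyMono₂ r₁ r₂] :
    Mono (kernel.ι r₁ ≫ r₂) where
  right_cancellation f g h := by
    rw [← cancel_mono (kernel.ι r₁)]
    apply JointlyMono₂.right_cancellation (p₁ := r₁) (p₂ := r₂)
    · simp
    · simpa using h

/-- The normalisation `r₂ ∘ ker r₁ : Ker r₁ ⟶ X` of an equivalence relation `(r₁, r₂)` on `X`. -/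
def normalisation {R X : C} {r₁ r₂ : R ⟶ X} (hR : EquivalenceRelation r₁ r₂) : Subobject X :=
  haveI : JointlyMono₂ r₁ r₂ := hR.toJointlyMono₂
  Subobject.mk (kernel.ι r₁ ≫ r₂)

/-- `(t₁, t₂)` is the denormalisation of the subobject `N` of `X`: the kernel pair of a cokernel
of `N ⟶ X`. -/
def IsDenormalisation {X T : C} (N : Subobject X) (t₁ t₂ : T ⟶ X) : Prop :=
  ∃ (Q : C) (c : X ⟶ Q) (w : N.arrow ≫ c = 0),
    Nonempty (IsColimit (CokernelCofork.ofπ c w)) ∧ IsKernelPair c t₁ t₂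

/-! ### Conjugation actions and semi-direct products -/

/-- `γ : N ⊗ X ⟶ N` is the conjugation action of `X` on `n : N ⟶ X`: the (unique, as `n` is
monic) morphism with `n ∘ γ = c₂ ∘ (n ⊗ 1)`, where `c₂ : X ⊗ X ⟶ X` is the commutator morphism. -/
def IsConjugationAction {N X : C} (n : N ⟶ X) (γ : cosmash₂ N X ⟶ N) : Prop :=
  γ ≫ n = cosmashMap₂ n (𝟙 X) ≫ commutatorMorphism₂ X

/-- `q : A + G ⟶ P` exhibits `P` as the semi-direct product `A ⋊ G` along `ψ : A ⊗ G ⟶ A`: it is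
a coequaliser of the inclusion `A ⊗ G ⟶ A + G` and `ι_A ∘ ψ`, and `q ∘ ι_A` is a monomorphism. -/
def IsSemidirectProduct {A G P : C} (ψ : cosmash₂ A G ⟶ A) (q : A ⨿ G ⟶ P) : Prop :=
  (∃ w : cosmashι₂ A G ≫ q = (ψ ≫ coprod.inl) ≫ q, Nonempty (IsColimit (Cofork.ofπ q w))) ∧
    Mono (coprod.inl ≫ q)

/-- The reflexive graph `(t₁, t₂, σ)` on `X` is the semi-direct product `N ⋊ X` along
`γ : N ⊗ X ⟶ N`, with first leg `0` on `N` and `1` on `X`, with second leg the inclusion on `N`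
and `1` on `X`, and with `σ` the canonical inclusion of `X`. -/
def IsSemidirectGraph {X T : C} (N : Subobject X) (γ : cosmash₂ (N : C) X ⟶ (N : C))
    (t₁ t₂ : T ⟶ X) (σ : X ⟶ T) : Prop :=
  ∃ q : (N : C) ⨿ X ⟶ T, IsSemidirectProduct γ q ∧
    q ≫ t₁ = coprod.desc 0 (𝟙 X) ∧ q ≫ t₂ = coprod.desc N.arrow (𝟙 X) ∧ coprod.inr ≫ q = σ

/-! ### The Smith commutator -/

/-- The reflexive relations `(r₁, r₂)` and `(s₁, s₂)` on `X` Smith-commute: there is a connector,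
a morphism `θ` on the pullback of `r₁` and `s₂` with `θ ∘ ⟨1, Δ_S r₁⟩ = r₂` and
`θ ∘ ⟨Δ_R s₂, 1⟩ = s₁`. -/
def SmithCommute {X R S : C} {r₁ r₂ : R ⟶ X} {s₁ s₂ : S ⟶ X}
    (hR : ReflexiveRelation r₁ r₂) (hS : ReflexiveRelation s₁ s₂) : Prop :=
  ∃ θ : pullback r₁ s₂ ⟶ X,
    pullback.lift (𝟙 R) (r₁ ≫ hS.r) (by simp) ≫ θ = r₂ ∧
    pullback.lift (s₂ ≫ hR.r) (𝟙 S) (by simp) ≫ θ = s₁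

/-- The subobject of `Y × Y` which is the direct image of the relation `(r₁, r₂)` on `X` along
`q : X ⟶ Y`. -/
abbrev imageRel {X Y R : C} (r₁ r₂ : R ⟶ X) (q : X ⟶ Y) : C :=
  image (prod.lift (r₁ ≫ q) (r₂ ≫ q))

/-- First projection of the direct image relation. -/
def imageRelFst {X Y R : C} (r₁ r₂ : R ⟶ X) (q : X ⟶ Y) : imageRel r₁ r₂ q ⟶ Y :=
  image.ι (prod.lift (r₁ ≫ q) (r₂ ≫ q)) ≫ prod.fst

/-- Second projection of the direct image relation. -/
def imageRelSnd {X Y R : C} (r₁ r₂ : R ⟶ X) (q : X ⟶ Y) : imageRel r₁ r₂ q ⟶ Y :=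
  image.ι (prod.lift (r₁ ≫ q) (r₂ ≫ q)) ≫ prod.snd

lemma imageRel_sq {X Y R : C} {r₁ r₂ : R ⟶ X} (hR : ReflexiveRelation r₁ r₂) (q : X ⟶ Y) :
    CommSq (hR.r ≫ factorThruImage (prod.lift (r₁ ≫ q) (r₂ ≫ q))) q
      (image.ι (prod.lift (r₁ ≫ q) (r₂ ≫ q))) (prod.lift (𝟙 Y) (𝟙 Y)) where
  w := by ext <;> simp

/-- The direct image of a reflexive relation along a regular epimorphism is reflexive. -/
def imageReflexive {X Y R : C} {r₁ r₂ : R ⟶ X} (hR : ReflexiveRelation r₁ r₂)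
    (q : X ⟶ Y) [IsRegularEpi q] :
    ReflexiveRelation (imageRelFst r₁ r₂ q) (imageRelSnd r₁ r₂ q) where
  right_cancellation W f g h₁ h₂ := by
    simp only [imageRelFst, imageRelSnd] at h₁ h₂
    rw [← cancel_mono (image.ι (prod.lift (r₁ ≫ q) (r₂ ≫ q)))]
    ext
    · simpa using h₁
    · simpa using h₂
  r := (imageRel_sq hR q).lift
  reflexivity₁ := by
    have h := (imageRel_sq hR q).fac_right
    rw [imageRelFst, ← Category.assoc, h, prod.lift_fst]
  reflexivity₂ := by
    have h := (imageRel_sq hR q).fac_right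
    rw [imageRelSnd, ← Category.assoc, h, prod.lift_snd]

/-- Dividing out the equivalence relation `(t₁, t₂)` makes `R` and `S` commute: for a quotient
`q : X ⟶ X / T` (a regular epimorphism with kernel pair `T`), the direct images of `R` and `S`
along `q` Smith-commute. -/
def CommuteModulo {X R S T : C} {r₁ r₂ : R ⟶ X} {s₁ s₂ : S ⟶ X}
    (hR : ReflexiveRelation r₁ r₂) (hS : ReflexiveRelation s₁ s₂) (t₁ t₂ : T ⟶ X) : Prop :=
  ∃ (Y : C) (q : X ⟶ Y) (_ : IsRegularEpi q), IsKernelPair q t₁ t₂ ∧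
    SmithCommute (imageReflexive hR q) (imageReflexive hS q)

/-- `(t₁, t₂)` is (up to isomorphism) the Smith commutator of the equivalence relations `R` and
`S`: the smallest equivalence relation on `X` that, when divided out, makes `R` and `S` commute. -/
structure IsSmithCommutator {X R S T : C} {r₁ r₂ : R ⟶ X} {s₁ s₂ : S ⟶ X}
    (hR : EquivalenceRelation r₁ r₂) (hS : EquivalenceRelation s₁ s₂) (t₁ t₂ : T ⟶ X) : Prop where
  isEquivalenceRelation : IsEquivalenceRelation t₁ t₂
  commuteModulo : CommuteModulo hR.toReflexiveRelation hS.toReflexiveRelation t₁ t₂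
  le {T' : C} (t₁' t₂' : T' ⟶ X) (_ : IsEquivalenceRelation t₁' t₂')
    (_ : CommuteModulo hR.toReflexiveRelation hS.toReflexiveRelation t₁' t₂') :
    ∃ m : T ⟶ T', m ≫ t₁' = t₁ ∧ m ≫ t₂' = t₂

end SemiAb

end

/-! The theorem rests on one criterion (`smithCommute_image_iff`): for a regular epimorphism `q` on
`X`, the direct images of `R` and `S` along `q` Smith-commute exactly when `q` annihilates `N = [K,
L, X] ∨ [K, L]`. Once `N` is known to be the kernel of a regular epimorphism `c`, the kernel pair of
`c` is the smallest relation to divide out, because every competing quotient annihilates `N` and so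
factors through `c`.

The criterion comes from `smithCommute_iff`. The pullback underlying a connector is a regular
quotient of `K + L + X`, and the two equations on a connector prescribe its composite with this
quotient. A connector therefore exists iff the prescribed morphism kills the kernel of the quotient
map. By protomodularity it suffices to test this on the kernel of `K + L + X ⟶ (K + X) × (L + X)`.
That kernel is generated by `K ⊗ L` and `K ⊗ L ⊗ X` (`exists_factorisation_weighted`), so its image
in `X` is `N`.

Normality holds because `N` is the image of a kernel along a regular epimorphism
(`exists_isLimit_imageSubobject`); this uses the Mal'tsev property and Barr exactness. The kernel
pair of `c` is identified with `N ⋊ X` in `exists_isSemidirectGraph`.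

If `K ∨ L = X`, a quotient killing `[K, L]` is covered by `K × L`, and over that cover the criterion
holds automatically. Hence `N = [K, L]`. -/

noncomputable section

namespace SemiAb

variable {C : Type u} [Category.{v} C] [HasZeroMorphisms C] [SemiAbelian C]

attribute [local simp] prod.lift_fst prod.lift_snd prod.lift_fst_assoc prod.lift_snd_assoc
  coprod.inl_desc coprod.inr_desc coprod.inl_desc_assoc coprod.inr_desc_assoc
  pullback.lift_fst pullback.lift_snd pullback.lift_fst_assoc pullback.lift_snd_assoc

/-! ### Consequences of protomodularity -/

/-- A subobject of `P` containing the section and the kernel of a split epimorphism on `P` is all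
of `P`. -/
lemma isIso_of_splitEpi {P G I : C} {p : P ⟶ G} {s : G ⟶ P} (hs : s ≫ p = 𝟙 G) (m : I ⟶ P) [Mono m]
    (k' : kernel p ⟶ I) (hk : k' ≫ m = kernel.ι p) (s' : G ⟶ I) (hs' : s' ≫ m = s) : IsIso m := by
  have w : k' ≫ m ≫ p = 0 := by rw [← Category.assoc, hk, kernel.condition]
  have lim : IsLimit (KernelFork.ofι k' w) :=
    KernelFork.IsLimit.ofι _ _
      (fun t ht => kernel.lift p (t ≫ m) (by simpa using ht))
      (fun t ht => by rw [← cancel_mono m]; simp [hk])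
      (fun t ht b hb => by
        rw [← cancel_mono (kernel.ι p), kernel.lift_ι, ← hb, Category.assoc, hk])
  exact SemiAbelian.split_short_five w lim (by rw [← Category.assoc, hs', hs])
    (kernel.condition p) (kernelIsKernel p) hs (𝟙 _) m (𝟙 _) (by simp [hk]) (by simp)
    (by simp [hs']) inferInstance inferInstance

/-- In a regular category extremal epimorphisms are regular. In this form, surjectivity follows from
generation statements such as `isIso_of_splitEpi`. -/
lemma isRegularEpi_of_forall_isIso {E P : C} (e : E ⟶ P)
    (h : ∀ {I : C} (m : I ⟶ P) [Mono m] (i : E ⟶ I), i ≫ m = e → IsIso m) : IsRegularEpi e := by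
  have : ExtremalEpi e := ExtremalEpi.mk_of_hasEqualizers e (fun _ i m hi _ => h m i hi)
  infer_instance

omit [HasZeroMorphisms C] [SemiAbelian C] in
-- Regular epimorphisms are orthogonal to monomorphisms, so containment in a subobject may be tested
-- on a cover.
lemma exists_lift_of_isRegularEpi {A B I P : C} (e : A ⟶ B) [IsRegularEpi e] (m : I ⟶ P) [Mono m]
    {u : A ⟶ I} {v : B ⟶ P} (h : u ≫ m = e ≫ v) : ∃ w : B ⟶ I, w ≫ m = v :=
  ⟨(CommSq.mk h).lift, (CommSq.mk h).fac_right⟩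

lemma isRegularEpi_comp {A B D : C} (f : A ⟶ B) (g : B ⟶ D) [IsRegularEpi f] [IsRegularEpi g] :
    IsRegularEpi (f ≫ g) := by
  have := strongEpi_comp f g
  infer_instance

lemma isRegularEpi_of_comp {A B D : C} (f : A ⟶ B) (g : B ⟶ D) [IsRegularEpi (f ≫ g)] :
    IsRegularEpi g := by
  have := strongEpi_of_strongEpi f g
  infer_instance

/-- The section and the kernel of a split epimorphism are jointly epimorphic. -/
lemma hom_ext_of_splitEpi {P G Y : C} {p : P ⟶ G} {s : G ⟶ P} (hs : s ≫ p = 𝟙 G) {f g : P ⟶ Y}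
    (hk : kernel.ι p ≫ f = kernel.ι p ≫ g) (h : s ≫ f = s ≫ g) : f = g := by
  have := isIso_of_splitEpi hs (equalizer.ι f g) (equalizer.lift _ hk) (by simp)
    (equalizer.lift _ h) (by simp)
  rw [← cancel_epi (equalizer.ι f g), equalizer.condition]

/-- A subobject of `P` which contains the kernel of `p : P ⟶ B`, and is mapped onto `B`, is all
of `P`. -/
lemma isIso_of_kernel_le {I P B : C} (m : I ⟶ P) [Mono m] (p : P ⟶ B) [IsRegularEpi (m ≫ p)]
    (k' : kernel p ⟶ I) (hk : k' ≫ m = kernel.ι p) : IsIso m := by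
  -- Pulling `p` back along `m ≫ p` produces a split epimorphism, with section given by `m`. The
  -- pullback of `m` contains its kernel and section, so is invertible; `m` is then a regular
  -- epimorphism because a pullback of `m ≫ p` factors through it.
  let m' : pullback (m ≫ p) (m ≫ p) ⟶ pullback p (m ≫ p) :=
    pullback.lift (pullback.fst _ _ ≫ m) (pullback.snd _ _) (by simp [pullback.condition])
  have m'₁ : m' ≫ pullback.fst _ _ = pullback.fst _ _ ≫ m := pullback.lift_fst _ _ _
  have m'₂ : m' ≫ pullback.snd _ _ = pullback.snd _ _ := pullback.lift_snd _ _ _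
  have : Mono m' := ⟨fun f g h => by
    apply pullback.hom_ext
    · rw [← cancel_mono m, Category.assoc, Category.assoc, ← m'₁, reassoc_of% h]
    · rw [← m'₂, reassoc_of% h]⟩
  have hw : (kernel.ι (pullback.snd p (m ≫ p)) ≫ pullback.fst p (m ≫ p)) ≫ p = 0 := by
    rw [Category.assoc, pullback.condition, kernel.condition_assoc, zero_comp]
  have : IsIso m' := isIso_of_splitEpi (p := pullback.snd p (m ≫ p))
    (s := pullback.lift m (𝟙 I) (by simp)) (by simp) m'
    (pullback.lift (kernel.lift p _ hw ≫ k') 0 (by simp [reassoc_of% hk]))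
    (by
      apply pullback.hom_ext
      · rw [Category.assoc, m'₁, pullback.lift_fst_assoc, Category.assoc, hk, kernel.lift_ι]
      · rw [Category.assoc, m'₂, pullback.lift_snd, kernel.condition])
    (pullback.lift (𝟙 I) (𝟙 I) rfl)
    (by
      apply pullback.hom_ext
      · rw [Category.assoc, m'₁]; simp
      · rw [Category.assoc, m'₂]; simp)
  have e : (inv m' ≫ pullback.fst (m ≫ p) (m ≫ p)) ≫ m = pullback.fst p (m ≫ p) := by
    rw [Category.assoc, ← m'₁, IsIso.inv_hom_id_assoc]
  have : IsRegularEpi ((inv m' ≫ pullback.fst (m ≫ p) (m ≫ p)) ≫ m) := by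
    rw [e]; infer_instance
  have := isRegularEpi_of_comp (inv m' ≫ pullback.fst (m ≫ p) (m ≫ p)) m
  exact isIso_of_mono_of_strongEpi m

/-- A regular epimorphism is a cokernel of its kernel. -/
lemma exists_desc_of_kernel_comp_eq_zero {X Y Z : C} (f : X ⟶ Y) [IsRegularEpi f] (g : X ⟶ Z)
    (h : kernel.ι f ≫ g = 0) : ∃ d : Y ⟶ Z, f ≫ d = g := by
  -- The kernel pair is generated by the diagonal and the pairs `(0, k)` with `k` in the kernel of
  -- `f`.
  have key : pullback.fst f f ≫ g = pullback.snd f f ≫ g := by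
    apply hom_ext_of_splitEpi (p := pullback.fst f f) (s := pullback.lift (𝟙 X) (𝟙 X) rfl) (by simp)
    · have : (kernel.ι (pullback.fst f f) ≫ pullback.snd f f) ≫ f = 0 := by
        rw [Category.assoc, ← pullback.condition, kernel.condition_assoc, zero_comp]
      rw [kernel.condition_assoc, zero_comp, ← Category.assoc, ← kernel.lift_ι f _ this,
        Category.assoc, h, comp_zero]
    · simp
  exact ⟨_, Cofork.IsColimit.π_desc' ((IsKernelPair.of_hasPullback f).toCoequalizer' ) g key⟩

/-- In a morphism of reflexive graphs which is a regular epimorphism between the objects of arrows,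
the induced morphism between the kernels of the domain morphisms is a regular epimorphism. -/
lemma isRegularEpi_kernelMap {R X R' Y : C} {r : R ⟶ X} {δ : X ⟶ R} (hδ : δ ≫ r = 𝟙 X)
    {r' : R' ⟶ Y} {δ' : Y ⟶ R'} (ρ : R ⟶ R') [IsRegularEpi ρ] (q : X ⟶ Y)
    (w : r ≫ q = ρ ≫ r') (wδ : δ ≫ ρ = q ≫ δ') : IsRegularEpi (kernel.map r r' ρ q w) := by
  let φ : R ⟶ pullback q r' := pullback.lift r ρ w
  have φ₁ : φ ≫ pullback.fst _ _ = r := pullback.lift_fst _ _ _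
  have φ₂ : φ ≫ pullback.snd _ _ = ρ := pullback.lift_snd _ _ _
  have hφ : IsRegularEpi φ := by
    apply isRegularEpi_of_forall_isIso
    intro I m _ i him
    have h1 : IsRegularEpi (i ≫ m ≫ pullback.snd q r') := by
      rw [reassoc_of% him, φ₂]; infer_instance
    have h2 := isRegularEpi_of_comp i (m ≫ pullback.snd q r')
    -- An element of this kernel is `(y, 0)` with `q y = 0`. It equals `φ (δ y)`, since `ρ (δ y) =
    -- δ' (q y) = 0`.
    apply isIso_of_kernel_le m (pullback.snd q r')
      (kernel.ι (pullback.snd q r') ≫ pullback.fst q r' ≫ δ ≫ i)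
    apply pullback.hom_ext
    · simp [him, φ₁, hδ]
    · simp only [Category.assoc, him, φ₂, kernel.condition, wδ]
      rw [pullback.condition_assoc, kernel.condition_assoc, zero_comp]
  have sq : IsPullback (kernel.map r r' ρ q w) (kernel.ι r)
      (pullback.lift 0 (kernel.ι r') (by simp)) φ := by
    refine ⟨⟨?_⟩, ⟨PullbackCone.IsLimit.mk _ (fun c => kernel.lift r c.snd ?_) ?_ ?_ ?_⟩⟩
    · apply pullback.hom_ext <;> simp [φ₁, φ₂]
    · have := c.condition =≫ pullback.fst _ _
      simpa [φ₁] using this.symm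
    · intro c
      have := c.condition =≫ pullback.snd _ _
      rw [← cancel_mono (kernel.ι r')]
      simpa [φ₂] using this.symm
    · intro c
      simp
    · intro c m _ h
      rw [← cancel_mono (kernel.ι r)]
      simpa using h
  exact Regular.regularEpiIsStableUnderBaseChange.of_isPullback sq.flip hφ

/-- Semi-abelian categories are Mal'tsev categories. -/
lemma isEquivalenceRelation_of_reflexive {R X : C} {r₁ r₂ : R ⟶ X} (hR : ReflexiveRelation r₁ r₂) :
    IsEquivalenceRelation r₁ r₂ := by
  have hj := hR.toJointlyMono₂
  have : Mono (prod.lift r₁ r₂) := ⟨fun f g h => hj.right_cancellation f g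
    (by simpa using h =≫ prod.fst) (by simpa using h =≫ prod.snd)⟩
  -- In elements, `(a, b)` and `(a, c)` in `R` are sent to `(b, c)`, which must be shown to lie in
  -- `R`. The inverse image of `R` contains the diagonal, sent to `(b, b)`, and the kernel of the
  -- first projection, sent to pairs `(0, c)` already in `R`.
  let d : pullback r₁ r₁ ⟶ X ⨯ X := prod.lift (pullback.fst r₁ r₁ ≫ r₂) (pullback.snd r₁ r₁ ≫ r₂)
  have : IsIso (pullback.snd (prod.lift r₁ r₂) d) :=
    isIso_of_splitEpi (p := pullback.fst r₁ r₁) (s := pullback.lift (𝟙 R) (𝟙 R) rfl) (by simp) _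
      (pullback.lift (kernel.ι (pullback.fst r₁ r₁) ≫ pullback.snd r₁ r₁) (kernel.ι _)
        (by
          ext
          · simp [d, ← pullback.condition]
          · simp [d]))
      (by simp)
      (pullback.lift (r₂ ≫ hR.r) (pullback.lift (𝟙 R) (𝟙 R) rfl) (by ext <;> simp [d]))
      (by simp)
  let t : pullback r₁ r₁ ⟶ R := inv (pullback.snd (prod.lift r₁ r₂) d) ≫ pullback.fst _ _
  have ht : t ≫ prod.lift r₁ r₂ = d := by
    rw [Category.assoc, pullback.condition, IsIso.inv_hom_id_assoc]
  have t₁ : t ≫ r₁ = pullback.fst r₁ r₁ ≫ r₂ := by simpa [d] using ht =≫ prod.fst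
  have t₂ : t ≫ r₂ = pullback.snd r₁ r₁ ≫ r₂ := by simpa [d] using ht =≫ prod.snd
  -- Symmetry applies `t` to `(a, b)` and `(a, a)`; transitivity below applies it to `(b, a)` and
  -- `(b, c)`.
  let σ : R ⟶ R := pullback.lift (𝟙 R) (r₁ ≫ hR.r) (by simp) ≫ t
  have σ₁ : σ ≫ r₁ = r₂ := by simp [σ, t₁]
  have σ₂ : σ ≫ r₂ = r₁ := by simp [σ, t₂]
  exact ⟨⟨{ hR with
    s := σ
    symmetry₁ := σ₁
    symmetry₂ := σ₂
    c := pullback.cone r₂ r₁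
    isLimit := pullback.isLimit r₂ r₁
    t := pullback.lift (pullback.fst r₂ r₁ ≫ σ) (pullback.snd r₂ r₁)
      (by simp [σ₁, pullback.condition]) ≫ t
    transitivity₁ := by simp [t₁, σ₂]
    transitivity₂ := by simp [t₂] }⟩⟩

/-! ### The weighted comparison morphism -/

/-- The comparison morphism `K + L + X ⟶ (K + X) × (L + X)`. -/
def weightedComparison (K L X : C) : (K ⨿ L) ⨿ X ⟶ (K ⨿ X) ⨯ (L ⨿ X) :=
  prod.lift (coprod.desc (coprod.desc coprod.inl 0) coprod.inr)
    (coprod.desc (coprod.desc 0 coprod.inl) coprod.inr)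

lemma weightedComparison_fst (K L X : C) : weightedComparison K L X ≫ prod.fst =
    coprod.desc (coprod.desc coprod.inl 0) coprod.inr :=
  prod.lift_fst _ _

lemma weightedComparison_snd (K L X : C) : weightedComparison K L X ≫ prod.snd =
    coprod.desc (coprod.desc 0 coprod.inl) coprod.inr :=
  prod.lift_snd _ _

lemma weightedKernel_comp_fst (K L X : C) : kernel.ι (weightedComparison K L X) ≫
    coprod.desc (coprod.desc coprod.inl 0) coprod.inr = 0 := by
  rw [← weightedComparison_fst, kernel.condition_assoc, zero_comp]

lemma weightedKernel_comp_snd (K L X : C) : kernel.ι (weightedComparison K L X) ≫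
    coprod.desc (coprod.desc 0 coprod.inl) coprod.inr = 0 := by
  rw [← weightedComparison_snd, kernel.condition_assoc, zero_comp]

/-- By `hc` the idempotent `u ≫ j` preserves the kernel of `e`, which therefore splits over the
kernel of `j ≫ e`. Protomodularity allows the vanishing of `f` to be tested on the two pieces
separately. -/
lemma comp_eq_zero_of_retraction {E B P Y : C} (e : E ⟶ P) (u : E ⟶ B) (j : B ⟶ E)
    (hj : j ≫ u = 𝟙 B) (f : E ⟶ Y) (hc : ∀ {T : C} (t : T ⟶ E), t ≫ e = 0 → t ≫ u ≫ j ≫ e = 0)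
    (h₁ : ∀ {T : C} (t : T ⟶ B), t ≫ j ≫ e = 0 → t ≫ j ≫ f = 0)
    (h₂ : ∀ {T : C} (t : T ⟶ E), t ≫ e = 0 → t ≫ u = 0 → t ≫ f = 0)
    {T : C} (t : T ⟶ E) (ht : t ≫ e = 0) : t ≫ f = 0 := by
  let p : kernel e ⟶ kernel (j ≫ e) :=
    kernel.lift _ (kernel.ι e ≫ u) (by simp [hc])
  let s : kernel (j ≫ e) ⟶ kernel e :=
    kernel.lift _ (kernel.ι (j ≫ e) ≫ j) (by simp)
  have hs : s ≫ p = 𝟙 _ := by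
    rw [← cancel_mono (kernel.ι (j ≫ e))]
    simp [s, p, hj]
  have : kernel.ι e ≫ f = 0 := by
    apply hom_ext_of_splitEpi hs
    · rw [comp_zero, ← Category.assoc]
      apply h₂
      · simp
      · have : p ≫ kernel.ι (j ≫ e) = kernel.ι e ≫ u := kernel.lift_ι _ _ _
        rw [Category.assoc, ← this, kernel.condition_assoc, zero_comp]
    · rw [comp_zero]
      simpa [s] using h₁ _ (kernel.condition (j ≫ e))
  rw [← kernel.lift_ι e t ht, Category.assoc, this, comp_zero]

/-- Two reflexive relations on `Y` Smith-commute precisely when the kernel of the weighted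
comparison `K + L + X ⟶ (K + X) × (L + X)` is annihilated by `K + L + X ⟶ Y`, where `K` and `L`
cover their kernels and `X` covers `Y`. -/
theorem smithCommute_iff {K L X Y R S : C} {r₁ r₂ : R ⟶ Y} {s₁ s₂ : S ⟶ Y}
    (hR : ReflexiveRelation r₁ r₂) (hS : ReflexiveRelation s₁ s₂)
    (a : K ⟶ kernel r₁) [IsRegularEpi a] (b : L ⟶ kernel s₂) [IsRegularEpi b]
    (x : X ⟶ Y) [IsRegularEpi x] {k : K ⟶ Y} {l : L ⟶ Y}
    (hk : a ≫ kernel.ι r₁ ≫ r₂ = k) (hl : b ≫ kernel.ι s₂ ≫ s₁ = l) :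
    SmithCommute hR hS ↔
      kernel.ι (weightedComparison K L X) ≫ coprod.desc (coprod.desc k l) x = 0 := by
  let f : (K ⨿ L) ⨿ X ⟶ Y := coprod.desc (coprod.desc k l) x
  let u : (K ⨿ L) ⨿ X ⟶ K ⨿ X := coprod.desc (coprod.desc coprod.inl 0) coprod.inr
  let v : (K ⨿ L) ⨿ X ⟶ L ⨿ X := coprod.desc (coprod.desc 0 coprod.inl) coprod.inr
  let π : (K ⨿ L) ⨿ X ⟶ X := coprod.desc 0 (𝟙 X)
  let α : K ⨿ X ⟶ R := coprod.desc (a ≫ kernel.ι r₁) (x ≫ hR.r)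
  let β : L ⨿ X ⟶ S := coprod.desc (b ≫ kernel.ι s₂) (x ≫ hS.r)
  let jK : K ⨿ X ⟶ (K ⨿ L) ⨿ X := coprod.desc (coprod.inl ≫ coprod.inl) coprod.inr
  let jL : L ⨿ X ⟶ (K ⨿ L) ⨿ X := coprod.desc (coprod.inr ≫ coprod.inl) coprod.inr
  let e : (K ⨿ L) ⨿ X ⟶ pullback r₁ s₂ :=
    pullback.lift (u ≫ α) (v ≫ β) (by ext <;> simp [u, v, α, β])
  have e₁ : e ≫ pullback.fst _ _ = u ≫ α := pullback.lift_fst _ _ _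
  have e₂ : e ≫ pullback.snd _ _ = v ≫ β := pullback.lift_snd _ _ _
  have eπ : u ≫ α ≫ r₁ = π ≫ x := by ext <;> simp [u, α, π]
  have jKu : jK ≫ u = 𝟙 _ := by ext <;> simp [jK, u]
  have jLv : jL ≫ v = 𝟙 _ := by ext <;> simp [jL, v]
  have jKv : jK ≫ v = coprod.desc 0 coprod.inr := by ext <;> simp [jK, v]
  have jLu : jL ≫ u = coprod.desc 0 coprod.inr := by ext <;> simp [jL, u]
  have jKe : jK ≫ e = α ≫ pullback.lift (𝟙 R) (r₁ ≫ hS.r) (by simp) := by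
    apply pullback.hom_ext
    · simp [e₁, reassoc_of% jKu]
    · simp only [Category.assoc, e₂, reassoc_of% jKv, pullback.lift_snd]
      ext <;> simp [α, β]
  have jLe : jL ≫ e = β ≫ pullback.lift (s₂ ≫ hR.r) (𝟙 S) (by simp) := by
    apply pullback.hom_ext
    · simp only [Category.assoc, e₁, reassoc_of% jLu, pullback.lift_fst]
      ext <;> simp [α, β]
    · simp [e₂, reassoc_of% jLv]
  have jKf : jK ≫ f = α ≫ r₂ := by ext <;> simp [jK, f, α, hk]
  have jLf : jL ≫ f = β ≫ s₁ := by ext <;> simp [jL, f, β, hl]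
  have hα : IsRegularEpi α := by
    apply isRegularEpi_of_forall_isIso
    intro I m _ i him
    obtain ⟨k', hk'⟩ := exists_lift_of_isRegularEpi a m (u := coprod.inl ≫ i) (v := kernel.ι r₁)
      (by simp [him, α])
    obtain ⟨s', hs'⟩ := exists_lift_of_isRegularEpi x m (u := coprod.inr ≫ i) (v := hR.r)
      (by simp [him, α])
    exact isIso_of_splitEpi hR.reflexivity₁ m k' hk' s' hs'
  have hβ : IsRegularEpi β := by
    apply isRegularEpi_of_forall_isIso
    intro I m _ i him
    obtain ⟨k', hk'⟩ := exists_lift_of_isRegularEpi b m (u := coprod.inl ≫ i) (v := kernel.ι s₂)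
      (by simp [him, β])
    obtain ⟨s', hs'⟩ := exists_lift_of_isRegularEpi x m (u := coprod.inr ≫ i) (v := hS.r)
      (by simp [him, β])
    exact isIso_of_splitEpi hS.reflexivity₂ m k' hk' s' hs'
  -- The second projection of the pullback is split. Its section is covered by `L + X` through `β`,
  -- and its kernel is that of `r₁`, covered by `K`.
  have he : IsRegularEpi e := by
    apply isRegularEpi_of_forall_isIso
    intro I m _ i him
    obtain ⟨s', hs'⟩ := exists_lift_of_isRegularEpi β m (u := jL ≫ i)
      (v := pullback.lift (s₂ ≫ hR.r) (𝟙 S) (by simp)) (by simpa [him] using jLe)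
    let z : kernel (pullback.snd r₁ s₂) ⟶ kernel r₁ :=
      kernel.lift _ (kernel.ι _ ≫ pullback.fst r₁ s₂) (by simp [pullback.condition])
    have hz : z ≫ kernel.ι r₁ = kernel.ι _ ≫ pullback.fst r₁ s₂ := kernel.lift_ι _ _ _
    obtain ⟨k', hk'⟩ := exists_lift_of_isRegularEpi a m (u := coprod.inl ≫ coprod.inl ≫ i)
      (v := pullback.lift (kernel.ι r₁) 0 (by simp)) (by
        simp only [Category.assoc, him]
        apply pullback.hom_ext
        · simp [e₁, u, α]
        · simp [e₂, v])
    refine isIso_of_splitEpi (p := pullback.snd r₁ s₂) (by simp) m (z ≫ k') ?_ s' hs'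
    rw [Category.assoc, hk']
    apply pullback.hom_ext
    · simp [hz]
    · simp
  constructor
  · rintro ⟨θ, h₁, h₂⟩
    have hf : e ≫ θ = f := by
      have hK : jK ≫ e ≫ θ = jK ≫ f := by rw [reassoc_of% jKe, h₁, jKf]
      have hL : jL ≫ e ≫ θ = jL ≫ f := by rw [reassoc_of% jLe, h₂, jLf]
      ext
      · simpa [jK] using coprod.inl ≫= hK
      · simpa [jL] using coprod.inl ≫= hL
      · simpa [jK] using coprod.inr ≫= hK
    have hw : kernel.ι (weightedComparison K L X) ≫ e = 0 := by
      have hu : kernel.ι (weightedComparison K L X) ≫ u = 0 :=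
        weightedKernel_comp_fst K L X
      have hv : kernel.ι (weightedComparison K L X) ≫ v = 0 :=
        weightedKernel_comp_snd K L X
      apply pullback.hom_ext
      · rw [Category.assoc, e₁, reassoc_of% hu, zero_comp, zero_comp]
      · rw [Category.assoc, e₂, reassoc_of% hv, zero_comp, zero_comp]
    change _ ≫ f = 0
    rw [← hf, reassoc_of% hw, zero_comp]
  · intro hw
    have pb {T : C} {t : T ⟶ (K ⨿ L) ⨿ X} (h : t ≫ e = 0) : t ≫ u ≫ α = 0 ∧ t ≫ v ≫ β = 0 := by
      constructor
      · rw [← e₁, reassoc_of% h, zero_comp]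
      · rw [← e₂, reassoc_of% h, zero_comp]
    have pb' {T : C} {t : T ⟶ (K ⨿ L) ⨿ X} (h₁ : t ≫ u ≫ α = 0) (h₂ : t ≫ v ≫ β = 0) :
        t ≫ e = 0 := by
      apply pullback.hom_ext
      · rw [Category.assoc, e₁, h₁, zero_comp]
      · rw [Category.assoc, e₂, h₂, zero_comp]
    have ujK : u ≫ jK ≫ v ≫ β = π ≫ x ≫ hS.r := by ext <;> simp [u, jK, v, β, π]
    have vjL : v ≫ jL ≫ u ≫ α = π ≫ x ≫ hR.r := by ext <;> simp [u, jL, v, α, π]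
    have ujπ : u ≫ jK ≫ π = π := by ext <;> simp [u, jK, π]
    have vjπ : v ≫ jL ≫ π = π := by ext <;> simp [v, jL, π]
    have vju : v ≫ jL ≫ u = π ≫ coprod.inr := by ext <;> simp [v, jL, u, π]
    -- The kernel of `e` is peeled along the retractions onto `X`, `K + X` and `L + X` in turn. On
    -- each retract `f` factors through a component of `e`, so vanishes; what remains is killed by
    -- `u` and `v` and lies in the weighted kernel.
    have key : kernel.ι e ≫ f = 0 := by
      apply comp_eq_zero_of_retraction e π coprod.inr (by simp [π]) f ?_ ?_ ?_ _
        (kernel.condition e)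
      · intro T t ht
        have h : t ≫ π ≫ x = 0 := by rw [← eπ, reassoc_of% (pb ht).1, zero_comp]
        rw [← Category.assoc, ← Category.assoc]
        apply pb'
        · simp [u, α, reassoc_of% h]
        · simp [v, β, reassoc_of% h]
      · intro T t ht
        rw [← Category.assoc] at ht
        have := (pb ht).1 =≫ r₁
        simpa [f, u, α] using this
      intro T t ht htπ
      refine comp_eq_zero_of_retraction (prod.lift e π) u jK jKu f ?_ ?_ ?_ t 
        (by apply Limits.prod.hom_ext <;> simp [ht, htπ])
      · intro T t ht
        have h₁ : t ≫ e = 0 := by simpa using ht =≫ prod.fst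
        have h₂ : t ≫ π = 0 := by simpa using ht =≫ prod.snd
        apply Limits.prod.hom_ext
        · simp only [Category.assoc, prod.lift_fst, zero_comp]
          rw [← Category.assoc, ← Category.assoc]
          apply pb'
          · simp only [Category.assoc, reassoc_of% jKu, (pb h₁).1]
          · simp only [Category.assoc, ujK, reassoc_of% h₂, zero_comp]
        · simp [ujπ, h₂]
      · intro T t ht
        have h₁ : (t ≫ jK) ≫ e = 0 := by simpa using ht =≫ prod.fst
        have := (pb h₁).1
        simp only [Category.assoc, reassoc_of% jKu] at this
        rw [jKf, reassoc_of% this, zero_comp]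
      intro T t ht htu
      refine comp_eq_zero_of_retraction (prod.lift (prod.lift e π) u) v jL jLv f ?_ ?_ ?_ t
        (by apply Limits.prod.hom_ext <;> simp [ht, htu])
      · intro T t ht
        have h₁ : t ≫ e = 0 := by simpa using (ht =≫ prod.fst) =≫ prod.fst
        have h₂ : t ≫ π = 0 := by simpa using (ht =≫ prod.fst) =≫ prod.snd
        apply Limits.prod.hom_ext
        · apply Limits.prod.hom_ext
          · simp only [Category.assoc, prod.lift_fst, zero_comp]
            rw [← Category.assoc, ← Category.assoc]
            apply pb'
            · simp only [Category.assoc, vjL, reassoc_of% h₂, zero_comp]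
            · simp only [Category.assoc, reassoc_of% jLv, (pb h₁).2]
          · simp [vjπ, h₂]
        · simp [vju, reassoc_of% h₂]
      · intro T t ht
        have h₁ : (t ≫ jL) ≫ e = 0 := by simpa using (ht =≫ prod.fst) =≫ prod.fst
        have := (pb h₁).2
        simp only [Category.assoc, reassoc_of% jLv] at this
        rw [jLf, reassoc_of% this, zero_comp]
      intro T t ht htv
      have htu : t ≫ u = 0 := by simpa using ht =≫ prod.snd
      have h : t ≫ weightedComparison K L X = 0 := by
        apply Limits.prod.hom_ext
        · rw [Category.assoc, weightedComparison_fst, htu, zero_comp]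
        · rw [Category.assoc, weightedComparison_snd, htv, zero_comp]
      rw [← kernel.lift_ι _ t h, Category.assoc, hw, comp_zero]
    obtain ⟨θ, hθ⟩ := exists_desc_of_kernel_comp_eq_zero e f key
    refine ⟨θ, ?_, ?_⟩
    · rw [← cancel_epi α, ← jKf, ← hθ, reassoc_of% jKe]
    · rw [← cancel_epi β, ← jLf, ← hθ, reassoc_of% jLe]

/-! ### Co-smash products inside the kernel of the weighted comparison -/

lemma comparison₂_fst (K L : C) : comparison₂ K L ≫ prod.fst = coprod.desc (𝟙 K) 0 := by
  ext <;> simp [comparison₂]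

lemma comparison₂_snd (K L : C) : comparison₂ K L ≫ prod.snd = coprod.desc 0 (𝟙 L) := by
  ext <;> simp [comparison₂]

lemma cosmashι₂_comparison₂ (K L : C) : cosmashι₂ K L ≫ comparison₂ K L = 0 :=
  kernel.condition _

lemma cosmashι₃_comparison₃ (K L X : C) : cosmashι₃ K L X ≫ comparison₃ K L X = 0 :=
  kernel.condition _

lemma cosmashι₂_comp_fst (K L : C) : cosmashι₂ K L ≫ coprod.desc (𝟙 K) 0 = 0 := by
  rw [← comparison₂_fst, reassoc_of% @cosmashι₂_comparison₂, zero_comp]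

lemma cosmashι₂_comp_snd (K L : C) : cosmashι₂ K L ≫ coprod.desc 0 (𝟙 L) = 0 := by
  rw [← comparison₂_snd, reassoc_of% @cosmashι₂_comparison₂, zero_comp]

lemma cosmashι₂_inl_weightedComparison (K L X : C) :
    (cosmashι₂ K L ≫ coprod.inl) ≫ weightedComparison K L X = 0 := by
  have h₁ : coprod.inl ≫ coprod.desc (coprod.desc coprod.inl 0) coprod.inr =
      coprod.desc (𝟙 K) (0 : L ⟶ K) ≫ (coprod.inl : K ⟶ K ⨿ X) := by ext <;> simp
  have h₂ : coprod.inl ≫ coprod.desc (coprod.desc 0 coprod.inl) coprod.inr =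
      coprod.desc (0 : K ⟶ L) (𝟙 L) ≫ (coprod.inl : L ⟶ L ⨿ X) := by ext <;> simp
  apply Limits.prod.hom_ext
  · rw [Category.assoc, Category.assoc, weightedComparison_fst, h₁, reassoc_of% @cosmashι₂_comp_fst,
      zero_comp, zero_comp]
  · rw [Category.assoc, Category.assoc, weightedComparison_snd, h₂, reassoc_of% @cosmashι₂_comp_snd,
      zero_comp, zero_comp]

lemma cosmashι₃_weightedComparison (K L X : C) :
    cosmashι₃ K L X ≫ weightedComparison K L X = 0 := by
  have h₁ : comparison₃ K L X ≫ prod.fst ≫ prod.snd =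
      coprod.desc (coprod.desc coprod.inl 0) coprod.inr := by simp [comparison₃]
  have h₂ : comparison₃ K L X ≫ prod.snd =
      coprod.desc (coprod.desc 0 coprod.inl) coprod.inr := by simp [comparison₃]
  apply Limits.prod.hom_ext
  · rw [Category.assoc, weightedComparison_fst, ← h₁, reassoc_of% @cosmashι₃_comparison₃, zero_comp,
      zero_comp]
  · rw [Category.assoc, weightedComparison_snd, ← h₂, reassoc_of% @cosmashι₃_comparison₃, zero_comp,
      zero_comp]

/-- The kernel of the weighted comparison is generated by `K ⊗ L` and `K ⊗ L ⊗ X`. -/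
lemma exists_factorisation_weighted {K L X Y I : C} (g : (K ⨿ L) ⨿ X ⟶ Y) (m : I ⟶ Y) [Mono m]
    {i₂ : cosmash₂ K L ⟶ I} (h₂ : i₂ ≫ m = cosmashι₂ K L ≫ coprod.inl ≫ g)
    {i₃ : cosmash₃ K L X ⟶ I} (h₃ : i₃ ≫ m = cosmashι₃ K L X ≫ g) :
    ∃ i : kernel (weightedComparison K L X) ⟶ I,
      i ≫ m = kernel.ι (weightedComparison K L X) ≫ g := by
  let W := kernel (weightedComparison K L X)
  let w : W ⟶ (K ⨿ L) ⨿ X := kernel.ι _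
  let c : (K ⨿ L) ⨿ X ⟶ K ⨿ L := coprod.desc (𝟙 _) 0
  have hu : w ≫ coprod.desc (coprod.desc coprod.inl 0) coprod.inr = 0 :=
    weightedKernel_comp_fst K L X
  have hv : w ≫ coprod.desc (coprod.desc 0 coprod.inl) coprod.inr = 0 :=
    weightedKernel_comp_snd K L X
  have hp : (w ≫ c) ≫ comparison₂ K L = 0 := by
    have h₁ : c ≫ comparison₂ K L ≫ prod.fst =
        coprod.desc (coprod.desc coprod.inl 0) coprod.inr ≫ coprod.desc (𝟙 K) (0 : X ⟶ K) := by
      ext <;> simp [c, comparison₂]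
    have h₂ : c ≫ comparison₂ K L ≫ prod.snd =
        coprod.desc (coprod.desc 0 coprod.inl) coprod.inr ≫ coprod.desc (𝟙 L) (0 : X ⟶ L) := by
      ext <;> simp [c, comparison₂]
    apply Limits.prod.hom_ext
    · simp only [Category.assoc, h₁, reassoc_of% hu, zero_comp]
    · simp only [Category.assoc, h₂, reassoc_of% hv, zero_comp]
  let p : W ⟶ cosmash₂ K L := kernel.lift _ _ hp
  have hpι : p ≫ cosmashι₂ K L = w ≫ c := kernel.lift_ι _ _ _
  let s : cosmash₂ K L ⟶ W := kernel.lift _ _ (cosmashι₂_inl_weightedComparison K L X)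
  have hsw : s ≫ w = cosmashι₂ K L ≫ coprod.inl := kernel.lift_ι _ _ _
  have hsp : s ≫ p = 𝟙 _ := by
    have : Mono (cosmashι₂ K L) := inferInstanceAs (Mono (kernel.ι _))
    rw [← cancel_mono (cosmashι₂ K L), Category.assoc, hpι, reassoc_of% hsw]
    simp [c]
  -- Elements of `W` already vanish on omitting `K` or `L`; those in the kernel of `p` also vanish
  -- on omitting `X`.
  have ht : (kernel.ι p ≫ w) ≫ comparison₃ K L X = 0 := by
    have h₁ : kernel.ι p ≫ w ≫ c = 0 := by
      rw [← hpι, kernel.condition_assoc, zero_comp]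
    apply Limits.prod.hom_ext
    · apply Limits.prod.hom_ext
      · have h₂ : comparison₃ K L X ≫ prod.fst ≫ prod.fst = c := by
          ext <;> simp [comparison₃, c]
        simp [h₂, h₁]
      · simp [comparison₃, hu]
    · simp [comparison₃, hv]
  let t : kernel p ⟶ cosmash₃ K L X := kernel.lift _ _ ht
  have htι : t ≫ cosmashι₃ K L X = kernel.ι p ≫ w := kernel.lift_ι _ _ _
  -- The inverse image of `m` in `W` contains the section `K ⊗ L` and the kernel of `p`, hence is
  -- everything.
  have : IsIso (pullback.snd m (w ≫ g)) :=
    isIso_of_splitEpi hsp _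
      (pullback.lift (t ≫ i₃) (kernel.ι p) (by rw [Category.assoc, h₃, reassoc_of% htι])) (by simp)
      (pullback.lift i₂ s (by rw [h₂, reassoc_of% hsw])) (by simp)
  exact ⟨inv (pullback.snd m (w ≫ g)) ≫ pullback.fst _ _, by simp [pullback.condition, w]⟩

/-- Both co-smash products map into the weighted kernel and together generate it. Presenting the
join as the image of a single kernel gives both its normality and its link with connectors. -/
lemma commutator_sup_eq_imageSubobject {X : C} (K L : Subobject X) :
    commutator₃ K L ⊤ ⊔ commutator₂ K L =
      imageSubobject (kernel.ι (weightedComparison (K : C) (L : C) ((⊤ : Subobject X) : C)) ≫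
        coprod.desc (coprod.desc K.arrow L.arrow) (⊤ : Subobject X).arrow) := by
  set g : ((K : C) ⨿ (L : C)) ⨿ ((⊤ : Subobject X) : C) ⟶ X :=
    coprod.desc (coprod.desc K.arrow L.arrow) (⊤ : Subobject X).arrow
  apply le_antisymm
  · apply sup_le
    · apply imageSubobject_le _
        (kernel.lift _ _ (cosmashι₃_weightedComparison (K : C) (L : C) ((⊤ : Subobject X) : C)) ≫
          factorThruImageSubobject _)
      simp [g]
    · apply imageSubobject_le _
        (kernel.lift _ _
            (cosmashι₂_inl_weightedComparison (K : C) (L : C) ((⊤ : Subobject X) : C)) ≫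
          factorThruImageSubobject _)
      simp [g]
  · let N := commutator₃ K L ⊤ ⊔ commutator₂ K L
    have h₂ : commutator₂ K L ≤ N := le_sup_right
    have h₃ : commutator₃ K L ⊤ ≤ N := le_sup_left
    let f₂ : cosmash₂ (K : C) (L : C) ⟶ (commutator₂ K L : C) := factorThruImageSubobject _
    let f₃ : cosmash₃ (K : C) (L : C) ((⊤ : Subobject X) : C) ⟶ (commutator₃ K L ⊤ : C) :=
      factorThruImageSubobject _
    have hf₂ : f₂ ≫ (commutator₂ K L).arrow = cosmashι₂ _ _ ≫ coprod.desc K.arrow L.arrow :=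
      imageSubobject_arrow_comp _
    have hf₃ : f₃ ≫ (commutator₃ K L ⊤).arrow = cosmashι₃ _ _ _ ≫ g := imageSubobject_arrow_comp _
    obtain ⟨i, hi⟩ := exists_factorisation_weighted g N.arrow
      (i₂ := f₂ ≫ Subobject.ofLE _ _ h₂) (i₃ := f₃ ≫ Subobject.ofLE _ _ h₃)
      (by simp [hf₂, g]) (by simp [hf₃])
    exact imageSubobject_le _ i hi

/-! ### Normality and semi-direct products -/

/-- The image of a kernel along a regular epimorphism is a kernel. -/
lemma exists_isLimit_imageSubobject {E G X : C} (g : E ⟶ G) (f : E ⟶ X) [IsRegularEpi f] :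
    ∃ (Z : C) (c : X ⟶ Z) (_ : IsRegularEpi c)
      (w : (imageSubobject (kernel.ι g ≫ f)).arrow ≫ c = 0),
      Nonempty (IsLimit (KernelFork.ofι _ w)) := by
  let r₁ := pullback.fst g g
  let r₂ := pullback.snd g g
  let hR : ReflexiveRelation r₁ r₂ :=
    { right_cancellation := fun _ _ _ h₁ h₂ => pullback.hom_ext h₁ h₂
      r := pullback.lift (𝟙 E) (𝟙 E) rfl
      reflexivity₁ := by simp [r₁]
      reflexivity₂ := by simp [r₂] }
  -- The direct image of the kernel pair of `g` is reflexive, hence an equivalence relation, hence a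
  -- kernel pair. Its normalisation is covered by that of the kernel pair of `g`, so it is the image
  -- of the kernel of `g`.
  let t₁ := imageRelFst r₁ r₂ f
  let t₂ := imageRelSnd r₁ r₂ f
  let ρ := factorThruImage (prod.lift (r₁ ≫ f) (r₂ ≫ f))
  have hρ₁ : ρ ≫ t₁ = r₁ ≫ f := by simp [ρ, t₁, imageRelFst]
  have hρ₂ : ρ ≫ t₂ = r₂ ≫ f := by simp [ρ, t₂, imageRelSnd]
  let hT : ReflexiveRelation t₁ t₂ := imageReflexive hR f
  obtain ⟨Y, c', hc'⟩ := SemiAbelian.effective t₁ t₂ (isEquivalenceRelation_of_reflexive hT)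
  let F := Regular.strongEpiMonoFactorisation c'
  have hc : IsKernelPair F.e t₁ t₂ := by
    apply IsKernelPair.cancel_right_of_mono (f₂ := F.m)
    rwa [F.fac]
  let N := imageSubobject (kernel.ι g ≫ f)
  let n : kernel g ⟶ (N : C) := factorThruImageSubobject _
  have hn : n ≫ N.arrow = kernel.ι g ≫ f := imageSubobject_arrow_comp _
  have hα : IsRegularEpi (kernel.map r₁ t₁ ρ f hρ₁.symm) :=
    isRegularEpi_kernelMap hR.reflexivity₁ ρ f hρ₁.symm (δ' := hT.r)
      (imageRel_sq hR f).fac_left.symm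
  have w : N.arrow ≫ F.e = 0 := by
    rw [← cancel_epi n, reassoc_of% hn, comp_zero]
    let z : kernel g ⟶ pullback g g := pullback.lift 0 (kernel.ι g) (by simp)
    have : kernel.ι g ≫ f = z ≫ ρ ≫ t₂ := by simp [hρ₂, z, r₂]
    rw [reassoc_of% this, ← hc.w, reassoc_of% hρ₁]
    simp [z, r₁]
  have hk : (kernel.ι r₁ ≫ r₂) ≫ g = 0 := by
    rw [Category.assoc, ← pullback.condition, kernel.condition_assoc, zero_comp]
  obtain ⟨k, hk⟩ := exists_lift_of_isRegularEpi (kernel.map r₁ t₁ ρ f hρ₁.symm) N.arrow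
    (u := kernel.lift g _ hk ≫ n) (v := kernel.ι t₁ ≫ t₂) (by simp [hn, hρ₂])
  refine ⟨_, F.e, inferInstance, w, ⟨KernelFork.IsLimit.ofι' _ _ fun {A} t ht => ?_⟩⟩
  have h₁ := hc.lift_fst 0 t (by simp [ht])
  refine ⟨kernel.lift t₁ (hc.lift 0 t (by simp [ht])) h₁ ≫ k, ?_⟩
  rw [Category.assoc, hk, kernel.lift_ι_assoc, hc.lift_snd]

/-- A regular epimorphism is a cokernel of its kernel. -/
lemma nonempty_isColimit_of_isLimit {X Z N : C} {c : X ⟶ Z} [IsRegularEpi c] {n : N ⟶ X}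
    {w : n ≫ c = 0} (h : IsLimit (KernelFork.ofι n w)) :
    Nonempty (IsColimit (CokernelCofork.ofπ c w)) := by
  have key {Y : C} (g : X ⟶ Y) (hg : n ≫ g = 0) : ∃ d : Z ⟶ Y, c ≫ d = g := by
    apply exists_desc_of_kernel_comp_eq_zero
    obtain ⟨k, hk⟩ := KernelFork.IsLimit.lift' h (kernel.ι c) (by simp)
    rw [← hk]
    simp [hg]
  exact ⟨CokernelCofork.IsColimit.ofπ' _ _ fun g hg => ⟨(key g hg).choose, (key g hg).choose_spec⟩⟩

/-- The kernel pair of a normal epimorphism is the semi-direct product of the kernel along the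
conjugation action. -/
lemma exists_isSemidirectGraph {X Z : C} (N : Subobject X) {c : X ⟶ Z} {w : N.arrow ≫ c = 0}
    (h : IsLimit (KernelFork.ofι N.arrow w)) (δ : X ⟶ pullback c c)
    (hδ₁ : δ ≫ pullback.fst c c = 𝟙 X) (hδ₂ : δ ≫ pullback.snd c c = 𝟙 X) :
    ∃ γ : cosmash₂ (N : C) X ⟶ (N : C), IsConjugationAction N.arrow γ ∧
      IsSemidirectGraph N γ (pullback.fst c c) (pullback.snd c c) δ := by
  have lift {T : C} (t : T ⟶ X) (ht : t ≫ c = 0) : ∃ l : T ⟶ (N : C), l ≫ N.arrow = t := by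
    obtain ⟨l, hl⟩ := KernelFork.IsLimit.lift' h t ht
    exact ⟨l, hl⟩
  let n := N.arrow
  let d₁ : (N : C) ⨿ X ⟶ X := coprod.desc 0 (𝟙 X)
  let d₂ : (N : C) ⨿ X ⟶ X := coprod.desc n (𝟙 X)
  have hd : d₂ ≫ c = d₁ ≫ c := by ext <;> simp [d₁, d₂, n, w]
  -- `ξ` is `d₂` restricted to the kernel of `d₁`. It is the identity on `N`, and on `N ⊗ X` it
  -- gives the conjugation action.
  obtain ⟨ξ, hξ⟩ := lift (kernel.ι d₁ ≫ d₂)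
    (by rw [Category.assoc, hd, kernel.condition_assoc, zero_comp])
  have hι₁ : cosmashι₂ (N : C) X ≫ d₁ = 0 :=
    cosmashι₂_comp_snd _ _
  let j : cosmash₂ (N : C) X ⟶ kernel d₁ := kernel.lift _ _ hι₁
  have hj : j ≫ kernel.ι d₁ = cosmashι₂ (N : C) X := kernel.lift_ι _ _ _
  let γ : cosmash₂ (N : C) X ⟶ (N : C) := j ≫ ξ
  have hγ : γ ≫ n = cosmashι₂ (N : C) X ≫ d₂ := by
    rw [Category.assoc, hξ, reassoc_of% hj]
  let q : (N : C) ⨿ X ⟶ pullback c c := pullback.lift d₁ d₂ hd.symm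
  have q₁ : q ≫ pullback.fst c c = d₁ := pullback.lift_fst _ _ _
  have q₂ : q ≫ pullback.snd c c = d₂ := pullback.lift_snd _ _ _
  have hqδ : coprod.inr ≫ q = δ := by
    apply pullback.hom_ext
    · rw [Category.assoc, q₁, hδ₁]; simp [d₁]
    · rw [Category.assoc, q₂, hδ₂]; simp [d₂]
  have hq : IsRegularEpi q := by
    apply isRegularEpi_of_forall_isIso
    intro I m _ i him
    obtain ⟨l, hl⟩ := lift (kernel.ι (pullback.fst c c) ≫ pullback.snd c c)
      (by rw [Category.assoc, ← pullback.condition, kernel.condition_assoc, zero_comp])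
    refine isIso_of_splitEpi hδ₁ m (l ≫ coprod.inl ≫ i) ?_ (coprod.inr ≫ i) ?_
    · apply pullback.hom_ext
      · simp [him, q₁, d₁]
      · simp [him, q₂, d₂, n, hl]
    · rw [Category.assoc, him, hqδ]
  have hw : cosmashι₂ (N : C) X ≫ q = (γ ≫ coprod.inl) ≫ q := by
    apply pullback.hom_ext
    · rw [Category.assoc, q₁, hι₁]
      simp [q₁, d₁]
    · rw [Category.assoc, q₂, ← hγ]
      simp [q₂, d₂]
  have hmono : Mono (coprod.inl ≫ q) := by
    have : (coprod.inl ≫ q) ≫ pullback.snd c c = n := by simp [q₂, d₂]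
    exact mono_of_mono_fac this
  have key {Y : C} (g : (N : C) ⨿ X ⟶ Y) (hg : cosmashι₂ (N : C) X ≫ g = (γ ≫ coprod.inl) ≫ g) :
      ∃ e, q ≫ e = g := by
    apply exists_desc_of_kernel_comp_eq_zero
    let s : (N : C) ⟶ kernel d₁ := kernel.lift _ coprod.inl (by simp [d₁])
    have hs : s ≫ kernel.ι d₁ = coprod.inl := kernel.lift_ι _ _ _
    let p : kernel d₁ ⟶ (N : C) := kernel.ι d₁ ≫ coprod.desc (𝟙 _) 0
    have hsp : s ≫ p = 𝟙 _ := by simp [p, reassoc_of% hs]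
    have hsξ : s ≫ ξ = 𝟙 _ := by
      rw [← cancel_mono N.arrow, Category.assoc, hξ, reassoc_of% hs]
      simp [d₂, n]
    -- The kernel of `d₁` is generated by `N` and `N ⊗ X`. On `N ⊗ X` the equation is the
    -- coequalising hypothesis `hg`. Since `ξ` vanishes on the kernel of `q`, so will `g`.
    have hκ : kernel.ι d₁ ≫ g = ξ ≫ coprod.inl ≫ g := by
      apply hom_ext_of_splitEpi hsp
      · have hz : (kernel.ι p ≫ kernel.ι d₁) ≫ comparison₂ (N : C) X = 0 := by
          have h₂ : comparison₂ (N : C) X ≫ prod.snd = d₁ := comparison₂_snd _ _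
          apply Limits.prod.hom_ext
          · rw [Category.assoc, Category.assoc, comparison₂_fst, zero_comp]
            exact kernel.condition p
          · rw [Category.assoc, Category.assoc, h₂, kernel.condition, comp_zero, zero_comp]
        let z : kernel p ⟶ cosmash₂ (N : C) X := kernel.lift _ _ hz
        have hzι : z ≫ cosmashι₂ (N : C) X = kernel.ι p ≫ kernel.ι d₁ := kernel.lift_ι _ _ _
        have hzj : z ≫ j = kernel.ι p := by
          rw [← cancel_mono (kernel.ι d₁), Category.assoc, hj, hzι]
        calc kernel.ι p ≫ kernel.ι d₁ ≫ g = z ≫ cosmashι₂ (N : C) X ≫ g := by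
              rw [reassoc_of% hzι]
          _ = kernel.ι p ≫ ξ ≫ coprod.inl ≫ g := by
              rw [hg, ← hzj]; simp [γ]
      · rw [reassoc_of% hs, reassoc_of% hsξ]
    have h₁ : kernel.ι q ≫ d₁ = 0 := by rw [← q₁, kernel.condition_assoc, zero_comp]
    have h₂ : kernel.lift _ _ h₁ ≫ ξ = 0 := by
      rw [← cancel_mono N.arrow, Category.assoc, hξ, kernel.lift_ι_assoc, ← q₂,
        kernel.condition_assoc, zero_comp, zero_comp]
    rw [← kernel.lift_ι d₁ _ h₁, Category.assoc, hκ, reassoc_of% h₂, zero_comp]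
  refine ⟨γ, ?_, q, ⟨⟨hw, ⟨?_⟩⟩, hmono⟩, q₁, q₂, hqδ⟩
  · have : cosmashMap₂ n (𝟙 X) ≫ cosmashι₂ X X = cosmashι₂ (N : C) X ≫ coprod.map n (𝟙 X) :=
      kernel.lift_ι _ _ _
    change γ ≫ n = cosmashMap₂ n (𝟙 X) ≫ commutatorMorphism₂ X
    rw [hγ, commutatorMorphism₂, reassoc_of% this]
    congr 1
    ext <;> simp [d₂]
  · exact Cofork.IsColimit.mk _ (fun s => (key s.π s.condition).choose)
      (fun s => (key s.π s.condition).choose_spec)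
      (fun s m hm => by
        rw [← cancel_epi q, (key s.π s.condition).choose_spec]
        exact hm)

/-! ### Direct images along a quotient -/

/-- The normalisation of an equivalence relation covers that of its direct image. -/
lemma exists_cover_kernel_fst {X Y R : C} {r₁ r₂ : R ⟶ X} (hR : EquivalenceRelation r₁ r₂)
    (q : X ⟶ Y) [IsRegularEpi q] :
    ∃ a : (normalisation hR : C) ⟶ kernel (imageRelFst r₁ r₂ q), IsRegularEpi a ∧
      a ≫ kernel.ι _ ≫ imageRelSnd r₁ r₂ q = (normalisation hR).arrow ≫ q := by
  have := hR.toJointlyMono₂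
  let ρ := factorThruImage (prod.lift (r₁ ≫ q) (r₂ ≫ q))
  have hρ₁ : ρ ≫ imageRelFst r₁ r₂ q = r₁ ≫ q := by simp [ρ, imageRelFst]
  have hρ₂ : ρ ≫ imageRelSnd r₁ r₂ q = r₂ ≫ q := by simp [ρ, imageRelSnd]
  have h : IsRegularEpi (kernel.map r₁ (imageRelFst r₁ r₂ q) ρ q hρ₁.symm) :=
    isRegularEpi_kernelMap hR.reflexivity₁ ρ q hρ₁.symm
      (δ' := (imageReflexive hR.toReflexiveRelation q).r)
      (imageRel_sq hR.toReflexiveRelation q).fac_left.symm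
  let i : (normalisation hR : C) ≅ kernel r₁ := Subobject.underlyingIso _
  have hi : i.hom ≫ kernel.ι r₁ ≫ r₂ = (normalisation hR).arrow :=
    Subobject.underlyingIso_hom_comp_eq_mk _
  refine ⟨i.hom ≫ kernel.map r₁ _ ρ q hρ₁.symm, isRegularEpi_comp _ _, ?_⟩
  rw [← hi]
  simp [hρ₂]

/-- The normalisation of an equivalence relation covers the kernel of the codomain morphism of its
direct image. -/
lemma exists_cover_kernel_snd {X Y R : C} {r₁ r₂ : R ⟶ X} (hR : EquivalenceRelation r₁ r₂)
    (q : X ⟶ Y) [IsRegularEpi q] :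
    ∃ a : (normalisation hR : C) ⟶ kernel (imageRelSnd r₁ r₂ q), IsRegularEpi a ∧
      a ≫ kernel.ι _ ≫ imageRelFst r₁ r₂ q = (normalisation hR).arrow ≫ q := by
  have hs₁ : hR.s ≫ r₁ = r₂ := hR.symmetry₁
  have hs₂ : hR.s ≫ r₂ = r₁ := hR.symmetry₂
  have hj := hR.toJointlyMono₂
  -- Precomposing with the symmetry exchanges the legs, so that the kernel of `r₁` covers the kernel
  -- of the second leg of the image.
  let ρ := hR.s ≫ factorThruImage (prod.lift (r₁ ≫ q) (r₂ ≫ q))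
  have hss : hR.s ≫ hR.s = 𝟙 R :=
    hj.right_cancellation _ _ (by simp [hs₁, hs₂]) (by simp [hs₁, hs₂])
  have : IsIso hR.s := ⟨hR.s, hss, hss⟩
  have hρ : IsRegularEpi ρ := isRegularEpi_comp _ _
  have hρ₁ : ρ ≫ imageRelSnd r₁ r₂ q = r₁ ≫ q := by simp [ρ, imageRelSnd, reassoc_of% hs₂]
  have hρ₂ : ρ ≫ imageRelFst r₁ r₂ q = r₂ ≫ q := by
    simp [ρ, imageRelFst, reassoc_of% hs₁]
  have hrs : hR.r ≫ hR.s = hR.r := hj.right_cancellation _ _ (by simp [hs₁]) (by simp [hs₂])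
  have h : IsRegularEpi (kernel.map r₁ (imageRelSnd r₁ r₂ q) ρ q hρ₁.symm) :=
    isRegularEpi_kernelMap hR.reflexivity₁ ρ q hρ₁.symm
      (δ' := (imageReflexive hR.toReflexiveRelation q).r)
      (by
        rw [reassoc_of% hrs]
        exact (imageRel_sq hR.toReflexiveRelation q).fac_left.symm)
  let i : (normalisation hR : C) ≅ kernel r₁ := Subobject.underlyingIso _
  have hi : i.hom ≫ kernel.ι r₁ ≫ r₂ = (normalisation hR).arrow :=
    Subobject.underlyingIso_hom_comp_eq_mk _
  refine ⟨i.hom ≫ kernel.map r₁ _ ρ q hρ₁.symm, isRegularEpi_comp _ _, ?_⟩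
  rw [← hi]
  simp [hρ₂]

/-- The direct images of `R` and `S` along `q` Smith-commute precisely when `q` annihilates
`[K, L, X] ∨ [K, L]`, where `K` and `L` are the normalisations of `R` and `S`. -/
theorem smithCommute_image_iff {X Y R S : C} {r₁ r₂ : R ⟶ X} {s₁ s₂ : S ⟶ X}
    (hR : EquivalenceRelation r₁ r₂) (hS : EquivalenceRelation s₁ s₂)
    (q : X ⟶ Y) [IsRegularEpi q] :
    SmithCommute (imageReflexive hR.toReflexiveRelation q)
        (imageReflexive hS.toReflexiveRelation q) ↔
      (commutator₃ (normalisation hR) (normalisation hS) ⊤ ⊔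
        commutator₂ (normalisation hR) (normalisation hS)).arrow ≫ q = 0 := by
  obtain ⟨a, _, ha⟩ := exists_cover_kernel_fst hR q
  obtain ⟨b, _, hb⟩ := exists_cover_kernel_snd hS q
  have := isRegularEpi_comp (⊤ : Subobject X).arrow q
  rw [smithCommute_iff _ _ a b ((⊤ : Subobject X).arrow ≫ q) ha hb,
    commutator_sup_eq_imageSubobject]
  set w := kernel.ι (weightedComparison (normalisation hR : C) (normalisation hS : C)
    ((⊤ : Subobject X) : C))
  set g := coprod.desc (coprod.desc (normalisation hR).arrow (normalisation hS).arrow)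
    (⊤ : Subobject X).arrow
  have hg : coprod.desc (coprod.desc ((normalisation hR).arrow ≫ q) ((normalisation hS).arrow ≫ q))
      ((⊤ : Subobject X).arrow ≫ q) = g ≫ q := by ext <;> simp [g]
  rw [hg, ← cancel_epi (factorThruImageSubobject (w ≫ g)), imageSubobject_arrow_comp_assoc,
    Category.assoc, comp_zero]

/-! ### Recognising the Smith commutator -/

/-- If `N` is the kernel of a regular epimorphism, and a regular epimorphism annihilates `N`
precisely when the direct images of `R` and `S` along it Smith-commute, then the semi-direct product
of `N` along the conjugation action is the Smith commutator of `R` and `S`. -/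
theorem isSmithCommutator_of_forall_iff {X R S Z : C} {r₁ r₂ : R ⟶ X} {s₁ s₂ : S ⟶ X}
    (hR : EquivalenceRelation r₁ r₂) (hS : EquivalenceRelation s₁ s₂) (N : Subobject X)
    (c : X ⟶ Z) [IsRegularEpi c] {w : N.arrow ≫ c = 0} (hN : IsLimit (KernelFork.ofι N.arrow w))
    (hcomm : ∀ {Y : C} (q : X ⟶ Y) [IsRegularEpi q],
      SmithCommute (imageReflexive hR.toReflexiveRelation q)
        (imageReflexive hS.toReflexiveRelation q) ↔ N.arrow ≫ q = 0) :
    IsNormalSubobject N ∧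
      ∃ γ : cosmash₂ (N : C) X ⟶ (N : C), IsConjugationAction N.arrow γ ∧
        ∃ (T : C) (t₁ t₂ : T ⟶ X) (hT : EquivalenceRelation t₁ t₂),
          IsSemidirectGraph N γ t₁ t₂ hT.r ∧ IsDenormalisation N t₁ t₂ ∧
            IsSmithCommutator hR hS t₁ t₂ := by
  have hc : IsKernelPair c (pullback.fst c c) (pullback.snd c c) := IsKernelPair.of_hasPullback c
  let hT : EquivalenceRelation (pullback.fst c c) (pullback.snd c c) :=
    IsKernelPair.equivalenceRelation c _ _ (pullback.isLimit _ _) hc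
  have hcolim := nonempty_isColimit_of_isLimit hN
  obtain ⟨γ, hγ, hγT⟩ := exists_isSemidirectGraph N hN hT.r hT.reflexivity₁ hT.reflexivity₂
  refine ⟨⟨⟨_, c, w, hN⟩⟩, γ, hγ, _, _, _, hT, hγT, ⟨_, c, w, hcolim, hc⟩,
    hT.isEquivalenceRelation, ⟨_, c, inferInstance, hc, (hcomm c).2 w⟩, ?_⟩
  rintro T' t₁' t₂' - ⟨Y, q, _, hq, hcom⟩
  obtain ⟨d, hd⟩ := CokernelCofork.IsColimit.desc' hcolim.some q ((hcomm q).1 hcom)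
  have hd' : c ≫ d = q := hd
  exact ⟨hq.lift _ _ (by rw [← hd', reassoc_of% hc.w]), hq.lift_fst _ _ _, hq.lift_snd _ _ _⟩

/-! ### The case where `K` and `L` cover `X` -/

lemma isRegularEpi_desc_of_sup_eq_top {X : C} {K L : Subobject X} (h : K ⊔ L = ⊤) :
    IsRegularEpi (coprod.desc K.arrow L.arrow) := by
  apply isRegularEpi_of_forall_isIso
  intro I m _ i hi
  have hK : K ≤ Subobject.mk m := Subobject.le_mk_of_comm (coprod.inl ≫ i) (by simp [hi])
  have hL : L ≤ Subobject.mk m := Subobject.le_mk_of_comm (coprod.inr ≫ i) (by simp [hi])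
  exact (Subobject.isIso_iff_mk_eq_top m).2 (top_le_iff.1 (h ▸ sup_le hK hL))

/-- A product is generated by its two axes: one is the section of the first projection, the other
its kernel. -/
lemma isRegularEpi_comparison₂ (K L : C) : IsRegularEpi (comparison₂ K L) := by
  apply isRegularEpi_of_forall_isIso
  intro I m _ i hi
  have hl : coprod.inl ≫ comparison₂ K L = prod.lift (𝟙 K) 0 := by simp [comparison₂]
  have hr : coprod.inr ≫ comparison₂ K L = prod.lift 0 (𝟙 L) := by simp [comparison₂]
  refine isIso_of_splitEpi (p := (prod.fst : K ⨯ L ⟶ K)) (s := prod.lift (𝟙 K) 0) (by simp) m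
    (kernel.ι _ ≫ prod.snd ≫ coprod.inr ≫ i) ?_ (coprod.inl ≫ i) ?_
  · simp only [Category.assoc, hi, hr]
    apply Limits.prod.hom_ext <;> simp
  · rw [Category.assoc, hi, hl]

/-- If the normalisations of `R` and `S` cover `X`, then the direct images of `R` and `S` along a
regular epimorphism annihilating `[K, L]` Smith-commute. -/
lemma smithCommute_image_of_sup_eq_top {X Y R S : C} {r₁ r₂ : R ⟶ X} {s₁ s₂ : S ⟶ X}
    (hR : EquivalenceRelation r₁ r₂) (hS : EquivalenceRelation s₁ s₂)
    (h : normalisation hR ⊔ normalisation hS = ⊤) (q : X ⟶ Y) [IsRegularEpi q]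
    (hq : (commutator₂ (normalisation hR) (normalisation hS)).arrow ≫ q = 0) :
    SmithCommute (imageReflexive hR.toReflexiveRelation q)
      (imageReflexive hS.toReflexiveRelation q) := by
  obtain ⟨a, _, ha⟩ := exists_cover_kernel_fst hR q
  obtain ⟨b, _, hb⟩ := exists_cover_kernel_snd hS q
  generalize normalisation hR = K at *
  generalize normalisation hS = L at *
  have := isRegularEpi_desc_of_sup_eq_top h
  have := isRegularEpi_comparison₂ (K : C) (L : C)
  have hKL : kernel.ι (comparison₂ (K : C) (L : C)) ≫ coprod.desc K.arrow L.arrow ≫ q = 0 := by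
    let f : cosmash₂ (K : C) (L : C) ⟶ (commutator₂ K L : C) := factorThruImageSubobject _
    have h₁ : f ≫ (commutator₂ K L).arrow =
        cosmashι₂ (K : C) (L : C) ≫ coprod.desc K.arrow L.arrow := imageSubobject_arrow_comp _
    have h₂ : cosmashι₂ (K : C) (L : C) ≫ coprod.desc K.arrow L.arrow ≫ q = 0 := by
      rw [← Category.assoc, ← h₁, Category.assoc, hq, comp_zero]
    exact h₂
  obtain ⟨ψ, hψ⟩ := exists_desc_of_kernel_comp_eq_zero (comparison₂ (K : C) (L : C)) _ hKL
  have : IsRegularEpi ψ := by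
    have : IsRegularEpi (comparison₂ (K : C) (L : C) ≫ ψ) := by
      rw [hψ]; exact isRegularEpi_comp _ _
    exact isRegularEpi_of_comp (comparison₂ (K : C) (L : C)) ψ
  -- The freedom to choose the cover of `Y` is used here: `K × L` takes the place of `X`. Each
  -- component of `f` then factors through a component of the weighted comparison, so `f` kills the
  -- weighted kernel.
  rw [smithCommute_iff _ _ a b ψ ha hb]
  let f : ((K : C) ⨿ (L : C)) ⨿ ((K : C) ⨯ (L : C)) ⟶ (K : C) ⨯ (L : C) :=
    coprod.desc (comparison₂ _ _) (𝟙 _)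
  have hf : coprod.desc (coprod.desc (K.arrow ≫ q) (L.arrow ≫ q)) ψ = f ≫ ψ := by
    ext <;> simp [f, hψ]
  have hf₁ : f ≫ prod.fst =
      coprod.desc (coprod.desc coprod.inl 0) coprod.inr ≫ coprod.desc (𝟙 _) prod.fst := by
    ext <;> simp [f, comparison₂_fst]
  have hf₂ : f ≫ prod.snd =
      coprod.desc (coprod.desc 0 coprod.inl) coprod.inr ≫ coprod.desc (𝟙 _) prod.snd := by
    ext <;> simp [f, comparison₂_snd]
  have hw : kernel.ι (weightedComparison _ _ _) ≫ f = 0 := by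
    apply Limits.prod.hom_ext
    · rw [Category.assoc, hf₁, reassoc_of% @weightedKernel_comp_fst, zero_comp, zero_comp]
    · rw [Category.assoc, hf₂, reassoc_of% @weightedKernel_comp_snd, zero_comp, zero_comp]
  rw [hf, reassoc_of% hw, zero_comp]

end SemiAb

end

theorem theorem4p13 {C : Type u} [Category.{v} C] [HasZeroMorphisms C] [SemiAbelian C]
    {X R S : C} {r₁ r₂ : R ⟶ X} {s₁ s₂ : S ⟶ X}
    (hR : EquivalenceRelation r₁ r₂) (hS : EquivalenceRelation s₁ s₂)
    (K L N : Subobject X)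
    (hK : K = SemiAb.normalisation hR) (hL : L = SemiAb.normalisation hS)
    (hN : N = SemiAb.commutator₃ K L ⊤ ⊔ SemiAb.commutator₂ K L) :
    (SemiAb.IsNormalSubobject N ∧
      ∃ γ : SemiAb.cosmash₂ (N : C) X ⟶ (N : C), SemiAb.IsConjugationAction N.arrow γ ∧
        ∃ (T : C) (t₁ t₂ : T ⟶ X) (hT : EquivalenceRelation t₁ t₂),
          SemiAb.IsSemidirectGraph N γ t₁ t₂ hT.r ∧
          SemiAb.IsDenormalisation N t₁ t₂ ∧
          SemiAb.IsSmithCommutator hR hS t₁ t₂) ∧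
    (K ⊔ L = ⊤ →
      SemiAb.IsNormalSubobject (SemiAb.commutator₂ K L) ∧
      ∃ γ : SemiAb.cosmash₂ (SemiAb.commutator₂ K L : C) X ⟶ (SemiAb.commutator₂ K L : C),
        SemiAb.IsConjugationAction (SemiAb.commutator₂ K L).arrow γ ∧
        ∃ (T : C) (t₁ t₂ : T ⟶ X) (hT : EquivalenceRelation t₁ t₂),
          SemiAb.IsSemidirectGraph (SemiAb.commutator₂ K L) γ t₁ t₂ hT.r ∧
          SemiAb.IsDenormalisation (SemiAb.commutator₂ K L) t₁ t₂ ∧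
          SemiAb.IsSmithCommutator hR hS t₁ t₂) := by
  subst hK hL
  have hcomm {Y : C} (q : X ⟶ Y) [IsRegularEpi q] := SemiAb.smithCommute_image_iff hR hS q
  rw [← hN] at hcomm
  constructor
  · have : IsRegularEpi (coprod.desc
        (coprod.desc (SemiAb.normalisation hR).arrow (SemiAb.normalisation hS).arrow)
        (⊤ : Subobject X).arrow) := by
      have : IsRegularEpi ((coprod.inr : _ ⟶ ((SemiAb.normalisation hR : C) ⨿
          (SemiAb.normalisation hS : C)) ⨿ ((⊤ : Subobject X) : C)) ≫ coprod.desc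
        (coprod.desc (SemiAb.normalisation hR).arrow (SemiAb.normalisation hS).arrow)
        (⊤ : Subobject X).arrow) := by
        rw [coprod.inr_desc]; infer_instance
      exact SemiAb.isRegularEpi_of_comp coprod.inr _
    obtain ⟨Z, c, _, w, ⟨h⟩⟩ := SemiAb.exists_isLimit_imageSubobject
      (SemiAb.weightedComparison (SemiAb.normalisation hR : C) (SemiAb.normalisation hS : C)
        ((⊤ : Subobject X) : C))
      (coprod.desc
        (coprod.desc (SemiAb.normalisation hR).arrow (SemiAb.normalisation hS).arrow)
        (⊤ : Subobject X).arrow)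
    rw [SemiAb.commutator_sup_eq_imageSubobject] at hN
    subst hN
    exact SemiAb.isSmithCommutator_of_forall_iff hR hS _ c h hcomm
  · intro htop
    have := SemiAb.isRegularEpi_desc_of_sup_eq_top htop
    obtain ⟨Z, c, _, w, ⟨h⟩⟩ := SemiAb.exists_isLimit_imageSubobject
      (SemiAb.comparison₂ (SemiAb.normalisation hR : C) (SemiAb.normalisation hS : C))
      (coprod.desc (SemiAb.normalisation hR).arrow (SemiAb.normalisation hS).arrow)
    -- The quotient by `[K, L]` already makes the direct images commute, so it annihilates `N`. This
    -- forces `N ≤ [K, L]`.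
    have hNc : N.arrow ≫ c = 0 :=
      (hcomm c).1 (SemiAb.smithCommute_image_of_sup_eq_top hR hS htop c w)
    obtain ⟨l, hl⟩ := KernelFork.IsLimit.lift' h N.arrow hNc
    have hle : N ≤ SemiAb.commutator₂ (SemiAb.normalisation hR) (SemiAb.normalisation hS) :=
      Subobject.le_of_comm l hl
    have hEq : SemiAb.commutator₂ (SemiAb.normalisation hR) (SemiAb.normalisation hS) = N :=
      le_antisymm (hN ▸ le_sup_right) hle
    refine SemiAb.isSmithCommutator_of_forall_iff hR hS _ c h ?_
    rw [hEq]
    exact hcomm
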